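/- All graphs are finite and simple. Write $S(r)=K_{1,r}$ for the star with $r$ edges, $jK_2$ for the disjoint union of $j$ copies of $K_2$ (a graph isomorphic to some $jK_2$ is called a matching), and $X\cup Y$ for the disjoint union of graphs. Write $F\to(G,H)$ if every red-blue coloring of the edges of $F$ contains a red copy of $G$ or a blue copy of $H$ (copies need not be induced). A graph $F$ is Ramsey-minimal for $(G,H)$ if $F\to(G,H)$ but $F'\not\to(G,H)$ for every proper subgraph $F'$ of $F$; let $\mathcal R(G,H)$ be the set of isomorphism classes of Ramsey-minimal graphs for $(G,H)$. The set $\mathcal R\bigl(S(5)\cup S(2),\,S(3)\cup 122K_2\bigr)$ is finite, neither $S(5)\cup S(2)$ nor $S(3)\cup 122K_2$ is a matching, and $S(5)\cup S(2)$ is not isomorphic to $S(r)\cup qK_2$ for any integers $r,q\ge 0$. Moreover, Burr's 1979 conjecture is false, that is, the following does not hold: for all graphs $G$ and $H$ that have at least one edge and no isolated vertices, $\mathcal R(G,H)$ is finite if and only if either at least one of $G$ and $H$ is a matching, or each of $G$ and $H$ is of the form $S(r)\cup qK_2$ with $r$ a positive odd integer and $q\ge 0$ (where $r$ and $q$ may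 be different for $G$ and $H$). -/

import Mathlib

open SimpleGraph

namespace RamseyMin

/-- `S(r) = K_{1,r}`, the star with `r` edges. -/
abbrev starG (r : ℕ) : SimpleGraph (Fin 1 ⊕ Fin r) :=
  completeBipartiteGraph (Fin 1) (Fin r)

/-- `jK₂`, the disjoint union of `j` copies of `K₂`; the `i`-th copy has vertices
`(i, false)` and `(i, true)`. -/
def matchingG (j : ℕ) : SimpleGraph (Fin j × Bool) where
  Adj x y := x.1 = y.1 ∧ x.2 ≠ y.2
  symm := ⟨fun _ _ h => ⟨h.1.symm, h.2.symm⟩⟩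
  loopless := ⟨fun _ h => h.2 rfl⟩

/-- `F → (G, H)`. A red-blue coloring of the edges of `F` is given by its red graph `R ≤ F`;
the blue graph is then `F \ R`. Copies need not be induced. -/
def Arrows {U V W : Type*} (F : SimpleGraph U) (G : SimpleGraph V) (H : SimpleGraph W) : Prop :=
  ∀ R : SimpleGraph U, R ≤ F → G.IsContained R ∨ H.IsContained (F \ R)

/-- `F` is Ramsey-minimal for `(G, H)`: `F → (G, H)`, but no proper subgraph of `F`
(obtained by deleting edges, vertices, or both) has this property. -/
def IsRamseyMinimal {U V W : Type*} (F : SimpleGraph U) (G : SimpleGraph V)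
    (H : SimpleGraph W) : Prop :=
  Arrows F G H ∧ ∀ F' : F.Subgraph, F' ≠ ⊤ → ¬ Arrows F'.coe G H

/-- Isomorphism of finite graphs, each represented on a vertex set `Fin n`. -/
def graphSetoid : Setoid (Σ n : ℕ, SimpleGraph (Fin n)) where
  r A B := Nonempty (A.2 ≃g B.2)
  iseqv := ⟨fun _ => ⟨Iso.refl⟩, fun ⟨f⟩ => ⟨f.symm⟩, fun ⟨f⟩ ⟨g⟩ => ⟨f.trans g⟩⟩

/-- Isomorphism classes of finite graphs. -/
def GraphClass : Type := Quotient graphSetoid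

/-- The isomorphism class of a graph on `Fin n`. -/
def GraphClass.mk {n : ℕ} (F : SimpleGraph (Fin n)) : GraphClass :=
  Quotient.mk graphSetoid ⟨n, F⟩

/-- `𝓡(G, H)`: the isomorphism classes of the finite Ramsey-minimal graphs for `(G, H)`. -/
def ramseyFamily {V W : Type*} (G : SimpleGraph V) (H : SimpleGraph W) : Set GraphClass :=
  {c | ∃ (n : ℕ) (F : SimpleGraph (Fin n)), IsRamseyMinimal F G H ∧ c = GraphClass.mk F}

/-- The pair `(G, H)` is Ramsey-finite. -/
def RamseyFinite {V W : Type*} (G : SimpleGraph V) (H : SimpleGraph W) : Prop :=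
  (ramseyFamily G H).Finite

/-- `G` is a matching, i.e. isomorphic to some `jK₂`. -/
def IsMatchingGraph {V : Type*} (G : SimpleGraph V) : Prop :=
  ∃ j : ℕ, Nonempty (G ≃g matchingG j)

/-- `G` is of the form `S(r) ∪ qK₂`. -/
def IsStarUnionMatching {V : Type*} (G : SimpleGraph V) (r q : ℕ) : Prop :=
  Nonempty (G ≃g (starG r ⊕g matchingG q))

/-- The standing hypotheses on target graphs: at least one edge and no isolated vertices. -/
def IsTarget {V : Type*} (G : SimpleGraph V) : Prop :=
  G ≠ ⊥ ∧ ∀ v, ∃ w, G.Adj v w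

/-- Burr's conjecture: `𝓡(G, H)` is finite if and only if one of `G`, `H` is a matching or both
are of the form `S(r) ∪ qK₂` with `r` odd (`r` and `q` may differ for the two graphs). -/
def BurrConjecture : Prop :=
  ∀ (V W : Type) [Finite V] [Finite W] (G : SimpleGraph V) (H : SimpleGraph W),
    IsTarget G → IsTarget H →
    (RamseyFinite G H ↔
      (IsMatchingGraph G ∨ IsMatchingGraph H) ∨
      ((∃ r q : ℕ, Odd r ∧ IsStarUnionMatching G r q) ∧
        (∃ r q : ℕ, Odd r ∧ IsStarUnionMatching H r q)))

end RamseyMin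

/-! The point is that a Ramsey-minimal graph F for the two targets has at most 256^4 vertices; only
finitely many graphs are that small. Minimality is used through good colourings, meaning colourings
of F minus one edge with no red S(5) ∪ S(2) and no blue S(3) ∪ 122K₂.

Degrees are at most 255: at a vertex of larger degree, a good colouring of F minus an incident edge
is so unbalanced that the edge can be returned to a dominant colour without creating a target.
Oddness of 5 and 3 enters through a Petersen-type theorem (`exists_split_four_two`): maximum degree
6 splits as 4 + 2, which avoids S(5) in red and S(3) in blue. So F has a vertex of degree at least
7. Call a vertex high if its degree is at least 5. There are at least 123 high vertices, as
otherwise colouring all edges at high vertices blue and the rest red would be good.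

Suppose F has more than 256^4 vertices. Then good colourings contain no red S(5)
(`IsCritical.red_degree_le`). Indeed, next to a red S(5), a blue S(3) would force all blue edges
onto a bounded cover, and a red S(2) would appear far away; without a blue S(3), nearly all high
vertices have red degree at least 3, and there are too many of them. It follows that every edge has
a high end, since an edge between two low vertices could be returned in red. Finally, remove an edge
avoiding a vertex of degree at least 7. That vertex has a blue S(3), so the blue edges have a
bounded cover; high vertices off the removed edge meet blue edges and lie near this cover, and all
vertices lie near high ones. This bounds the order, a contradiction. -/

namespace RamseyMin

/-! ### Stars and matchings inside a graph -/

section Copies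

variable {V W : Type*}

/-- `X` contains a copy of `K` that uses no vertex of `S`. -/
def HasCopyAvoiding (K : SimpleGraph W) (X : SimpleGraph V) (S : Finset V) : Prop :=
  ∃ g : K.Copy X, ∀ w, g w ∉ S

lemma HasCopyAvoiding.mono {K : SimpleGraph W} {X Y : SimpleGraph V} {S T : Finset V}
    (h : HasCopyAvoiding K X S) (hXY : X ≤ Y) (hTS : T ⊆ S) : HasCopyAvoiding K Y T := by
  obtain ⟨g, hg⟩ := h
  exact ⟨(Copy.ofLE X Y hXY).comp g, fun w hw => hg w (hTS (by simpa using hw))⟩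

lemma exists_copy_of_star {r : ℕ} {X : SimpleGraph V} {c : V} {A : Finset V} (hA : A.card = r)
    (hc : ∀ a ∈ A, X.Adj c a) :
    ∃ g : (starG r).Copy X, g (.inl 0) = c ∧ ∀ i, g (.inr i) ∈ A := by
  let e := (A.equivFinOfCardEq hA).symm
  let f : Fin 1 ⊕ Fin r → V := Sum.elim (fun _ => c) (fun i => (e i : V))
  have hadj : ∀ i, X.Adj c (e i) := fun i => hc _ (e i).2
  refine ⟨⟨⟨f, ?_⟩, ?_⟩, rfl, fun i => (e i).2⟩
  · rintro (i | i) (j | j) h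
    · simp at h
    · exact hadj j
    · exact (hadj i).symm
    · simp at h
  · rintro (i | i) (j | j) h
    · rw [Subsingleton.elim i j]
    · exact absurd h (hadj j).ne
    · exact absurd h (hadj i).ne'
    · exact congrArg _ (e.injective (Subtype.ext h))

/-- A graph covered by fewer than `k` vertices has no `k` independent edges. -/
lemma not_matchingG_isContained_of_cover {k : ℕ} {X : SimpleGraph V} {Y : Finset V}
    (hY : Y.card < k) (hc : ∀ a b, X.Adj a b → a ∈ Y ∨ b ∈ Y) :
    ¬ (matchingG k).IsContained X := by
  rintro ⟨g⟩
  have hex : ∀ i : Fin k, ∃ x, g (i, x) ∈ Y := fun i => by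
    rcases hc _ _ (g.toHom.map_adj (v := (i, false)) (w := (i, true)) ⟨rfl, by simp⟩) with h | h
    · exact ⟨_, h⟩
    · exact ⟨_, h⟩
  choose x hx using hex
  have hinj : Function.Injective fun i => g (i, x i) := fun i j h =>
    congrArg Prod.fst (g.injective h)
  have := Finset.card_le_card_of_injOn (s := Finset.univ) (t := Y) (fun i => g (i, x i))
    (fun i _ => hx i) hinj.injOn
  simp at this
  omega

variable [DecidableEq V]

lemma exists_star_of_copy {r : ℕ} {X : SimpleGraph V} (g : (starG r).Copy X) :
    ∃ A : Finset V, A.card = r ∧ (∀ a ∈ A, X.Adj (g (.inl 0)) a) ∧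
      ∀ a, a ∈ A ↔ ∃ i, g (.inr i) = a := by
  refine ⟨Finset.univ.image fun i => g (.inr i), ?_, ?_, ?_⟩
  · have : Function.Injective fun i => g (.inr i) := g.injective.comp Sum.inr_injective
    rw [Finset.card_image_of_injective _ this]
    simp
  · simp only [Finset.mem_image, Finset.mem_univ, true_and, forall_exists_index,
      forall_apply_eq_imp_iff]
    exact fun i => g.toHom.map_adj (by simp)
  · simp

lemma hasCopyAvoiding_starG_iff {r : ℕ} {X : SimpleGraph V} {S : Finset V} :
    HasCopyAvoiding (starG r) X S ↔
      ∃ (c : V) (A : Finset V), A.card = r ∧ (∀ a ∈ A, X.Adj c a) ∧ c ∉ S ∧ ∀ a ∈ A, a ∉ S := by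
  constructor
  · rintro ⟨g, hg⟩
    obtain ⟨A, hA, hadj, hmem⟩ := exists_star_of_copy g
    refine ⟨_, A, hA, hadj, hg _, fun a ha => ?_⟩
    obtain ⟨i, rfl⟩ := (hmem a).1 ha
    exact hg _
  · rintro ⟨c, A, hA, hadj, hc, hAS⟩
    obtain ⟨g, h0, hi⟩ := exists_copy_of_star hA hadj
    refine ⟨g, ?_⟩
    rintro (i | i)
    · rw [Subsingleton.elim i 0, h0]; exact hc
    · exact hAS _ (hi i)

lemma starG_sum_isContained_iff {r : ℕ} {K : SimpleGraph W} {X : SimpleGraph V} :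
    (starG r ⊕g K).IsContained X ↔
      ∃ (c : V) (A : Finset V), A.card = r ∧ (∀ a ∈ A, X.Adj c a) ∧
        HasCopyAvoiding K X (insert c A) := by
  constructor
  · rintro ⟨f⟩
    let g : (starG r).Copy X := f.comp Embedding.sumInl.toCopy
    let k : K.Copy X := f.comp Embedding.sumInr.toCopy
    have hne : ∀ x w, g x ≠ k w := fun x w h => by
      have := f.injective (show f (.inl x) = f (.inr w) from h)
      simp at this
    obtain ⟨A, hA, hadj, hmem⟩ := exists_star_of_copy g
    refine ⟨_, A, hA, hadj, k, fun w hw => ?_⟩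
    rcases Finset.mem_insert.1 hw with h | h
    · exact hne _ _ h.symm
    · obtain ⟨i, hi⟩ := (hmem _).1 h
      exact hne _ _ hi
  · rintro ⟨c, A, hA, hadj, k, hk⟩
    obtain ⟨g, h0, hi⟩ := exists_copy_of_star hA hadj
    have hg : ∀ x, g x ∈ insert c A := by
      rintro (i | i)
      · rw [Subsingleton.elim i 0, h0]; simp
      · exact Finset.mem_insert_of_mem (hi i)
    refine ⟨⟨⟨Sum.elim g k, ?_⟩, ?_⟩⟩
    · rintro (a | a) (b | b) h
      · exact g.toHom.map_adj (by simpa using h)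
      · simp at h
      · simp at h
      · exact k.toHom.map_adj (by simpa using h)
    · exact g.injective.sumElim k.injective fun x w h => hk w (by rw [← h]; exact hg x)

lemma hasCopyAvoiding_matchingG_succ {k : ℕ} {X : SimpleGraph V} {S : Finset V} {a b : V}
    (hab : X.Adj a b) (ha : a ∉ S) (hb : b ∉ S)
    (h : HasCopyAvoiding (matchingG k) X (insert a (insert b S))) :
    HasCopyAvoiding (matchingG (k + 1)) X S := by
  obtain ⟨g, hg⟩ := h
  simp only [Finset.mem_insert, not_or] at hg
  let f : Fin (k + 1) × Bool → V := fun p =>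
    Fin.cases (if p.2 then b else a) (fun i => g (i, p.2)) p.1
  refine ⟨⟨⟨f, ?_⟩, ?_⟩, ?_⟩
  · rintro ⟨i, x⟩ ⟨j, y⟩ ⟨hij, hxy⟩
    dsimp only at hij hxy
    subst hij
    induction i using Fin.cases with
    | zero => cases x <;> cases y <;> simp_all [f, hab.symm]
    | succ i => exact g.toHom.map_adj ⟨rfl, hxy⟩
  · rintro ⟨i, x⟩ ⟨j, y⟩ h
    change f (i, x) = f (j, y) at h
    induction i using Fin.cases with
    | zero =>
      induction j using Fin.cases with
      | zero => cases x <;> cases y <;> simp_all [f, hab.ne, hab.ne']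
      | succ j =>
        have := hg (j, y)
        cases x <;> simp_all [f]
    | succ i =>
      induction j using Fin.cases with
      | zero =>
        have := hg (i, x)
        cases y <;> simp_all [f]
      | succ j =>
        have := g.injective (show g (i, x) = g (j, y) from h)
        simp_all
  · rintro ⟨i, x⟩
    change f (i, x) ∉ S
    induction i using Fin.cases with
    | zero => cases x <;> simpa [f]
    | succ i => exact (hg (i, x)).2.2

/-- Edges are picked greedily outside `S`, adding both ends to `S`; if the process stops early, the
accumulated set is a cover. -/
lemma hasCopyAvoiding_matchingG_or_cover (X : SimpleGraph V) (k : ℕ) (S : Finset V) :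
    HasCopyAvoiding (matchingG k) X S ∨
      ∃ Y : Finset V, Y.card ≤ S.card + 2 * k ∧ ∀ a b, X.Adj a b → a ∈ Y ∨ b ∈ Y := by
  induction k generalizing S with
  | zero => exact .inl ⟨⟨⟨fun p => p.1.elim0, fun {p} => p.1.elim0⟩, fun p => p.1.elim0⟩,
      fun p => p.1.elim0⟩
  | succ k ih =>
    by_cases h : ∃ a b, X.Adj a b ∧ a ∉ S ∧ b ∉ S
    · obtain ⟨a, b, hab, ha, hb⟩ := h
      rcases ih (insert a (insert b S)) with h | ⟨Y, hY, hc⟩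
      · exact .inl (hasCopyAvoiding_matchingG_succ hab ha hb h)
      · refine .inr ⟨Y, ?_, hc⟩
        have h1 := Finset.card_insert_le a (insert b S)
        have h2 := Finset.card_insert_le b S
        omega
    · push Not at h
      refine .inr ⟨S, by omega, fun a b hab => ?_⟩
      by_cases ha : a ∈ S
      · exact .inl ha
      · by_contra hb
        exact hb (.inr (h a b hab ha))

/-- Dropping one edge frees a prescribed vertex. -/
lemma hasCopyAvoiding_matchingG_of_succ {k : ℕ} {X : SimpleGraph V}
    (h : (matchingG (k + 1)).IsContained X) (v : V) :
    HasCopyAvoiding (matchingG k) X {v} := by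
  obtain ⟨g⟩ := h
  -- The dropped edge `i` is the one through `v`, or an arbitrary one if the matching misses `v`.
  have key : ∀ i : Fin (k + 1), (∀ p : Fin (k + 1) × Bool, p.1 ≠ i → g p ≠ v) →
      HasCopyAvoiding (matchingG k) X {v} := by
    intro i hi
    refine ⟨⟨⟨fun p => g (i.succAbove p.1, p.2), ?_⟩, ?_⟩, ?_⟩
    · rintro ⟨a, x⟩ ⟨b, y⟩ ⟨hab, hxy⟩
      exact g.toHom.map_adj ⟨congrArg i.succAbove hab, hxy⟩
    · rintro ⟨a, x⟩ ⟨b, y⟩ h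
      have := g.injective h
      simp_all
    · rintro ⟨a, x⟩
      rw [Finset.mem_singleton]
      exact hi (i.succAbove a, x) (Fin.succAbove_ne i a)
  by_cases hv : ∃ p, g p = v
  · obtain ⟨p, rfl⟩ := hv
    exact key p.1 fun q hq h => hq (by rw [g.injective h])
  · push Not at hv
    exact key 0 fun p _ => hv p

/-- `S(r) ∪ kK₂` with `r ≥ 1` contains `(k+1)K₂`. -/
lemma matchingG_isContained_of_star {r k : ℕ} {X : SimpleGraph V}
    (h : (starG (r + 1) ⊕g matchingG k).IsContained X) : (matchingG (k + 1)).IsContained X := by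
  obtain ⟨c, A, hA, hadj, hm⟩ := starG_sum_isContained_iff.1 h
  obtain ⟨a, ha⟩ := Finset.card_pos.1 (by omega : 0 < A.card)
  have : HasCopyAvoiding (matchingG (k + 1)) X ∅ :=
    hasCopyAvoiding_matchingG_succ (hadj a ha) (by simp) (by simp)
      (hm.mono le_rfl (by intro x; simp; rintro (rfl | rfl) <;> simp [ha]))
  exact ⟨this.choose⟩

end Copies

/-! ### Splitting maximum degree 6 into 4 and 2 -/

section Splitting

/-- A relation in which every element of `α` has at least `d` partners and every element of `β`
has at most `d` partners admits a system of distinct representatives. -/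
lemma exists_injective_of_degrees {α β : Type*} [Fintype α] [Fintype β] (r : α → β → Prop)
    [∀ a b, Decidable (r a b)] {d : ℕ} (hd : 0 < d)
    (hα : ∀ a, d ≤ (Finset.univ.filter fun b => r a b).card)
    (hβ : ∀ b, (Finset.univ.filter fun a => r a b).card ≤ d) :
    ∃ f : α → β, Function.Injective f ∧ ∀ a, r a (f a) := by
  rw [← Fintype.all_card_le_filter_rel_iff_exists_injective]
  intro A
  refine Nat.le_of_mul_le_mul_right (Finset.card_mul_le_card_mul r (m := d) (n := d) ?_ ?_) hd
  · intro a ha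
    refine (hα a).trans (Finset.card_le_card fun b hb => ?_)
    simp only [Finset.mem_filter, Finset.mem_univ, true_and, Finset.mem_bipartiteAbove] at hb ⊢
    exact ⟨⟨a, ha, hb⟩, hb⟩
  · intro b _
    refine (Finset.card_le_card fun a ha => ?_).trans (hβ b)
    simp only [Finset.mem_filter, Finset.mem_univ, true_and, Finset.mem_bipartiteBelow] at ha ⊢
    exact ha.2

variable {V : Type*} [Fintype V]

open Classical in
/-- The neighbours of `v` in `X`, as a finset. -/
noncomputable def nbrs (X : SimpleGraph V) (v : V) : Finset V := Finset.univ.filter (X.Adj v)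

@[simp] lemma mem_nbrs {X : SimpleGraph V} {v w : V} : w ∈ nbrs X v ↔ X.Adj v w := by
  simp [nbrs]

lemma card_nbrs_le_add {F R B : SimpleGraph V} (h : F ≤ R ⊔ B) (v : V) :
    (nbrs F v).card ≤ (nbrs R v).card + (nbrs B v).card := by
  classical
  refine (Finset.card_le_card fun w hw => ?_).trans (Finset.card_union_le _ _)
  have := h (mem_nbrs.1 hw)
  simpa using this

/-- The edges of two copies of `F`, with parallel edges between the copies of each vertex that
raise all degrees to `6`. -/
abbrev PaddedEdge (F : SimpleGraph V) : Type _ :=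
  (F.edgeSet × Bool) ⊕ (Σ v : V, Fin (6 - (nbrs F v).card))

open Classical in
/-- An orientation with all out-degrees and in-degrees at most `3`. It comes from a perfect
matching between the edges of two copies of `F`, padded by parallel edges between the copies to a
`6`-regular multigraph, and three slots at each vertex. -/
lemma exists_balanced_orientation (F : SimpleGraph V) (hF : ∀ v, (nbrs F v).card ≤ 6) :
    ∃ O : V → V → Prop, (∀ u v, F.Adj u v ↔ O u v ∨ O v u) ∧ (∀ u v, O u v → ¬ O v u) ∧
      (∀ u, (Finset.univ.filter fun v => O u v).card ≤ 3) ∧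
      (∀ v, (Finset.univ.filter fun u => O u v).card ≤ 3) := by
  -- A padded edge is related to the slots of its two ends. The relation is 6-regular on both sides:
  -- an edge sees 2 · 3 slots, and a slot sees the 6 padded edges at its vertex.
  let r : PaddedEdge F → (V × Bool) × Fin 3 → Prop := fun x s =>
    Sum.elim (fun e => e.2 = s.1.2 ∧ s.1.1 ∈ (e.1 : Sym2 V)) (fun p => p.1 = s.1.1) x
  have hE : ∀ x : PaddedEdge F, (Finset.univ.filter fun s => r x s).card = 6 := by
    rintro (⟨⟨e, he⟩, β⟩ | ⟨v, j⟩)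
    · induction e with
      | _ a b =>
        have hab : a ≠ b := F.ne_of_adj he
        have : (Finset.univ.filter fun s => r (.inl (⟨s(a, b), he⟩, β)) s) =
            (({a, b} : Finset V) ×ˢ {β}) ×ˢ Finset.univ := by
          ext ⟨⟨w, γ⟩, i⟩
          simp only [r, Finset.mem_filter, Finset.mem_univ, true_and, Sum.elim_inl, Sym2.mem_iff,
            Finset.mem_product, Finset.mem_insert, Finset.mem_singleton, and_true]
          tauto
        rw [this]
        simp [hab]
    · have : (Finset.univ.filter fun s => r (.inr ⟨v, j⟩) s) =
          (({v} : Finset V) ×ˢ Finset.univ) ×ˢ Finset.univ := by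
        ext ⟨⟨w, γ⟩, i⟩
        rw [Finset.mem_filter]
        simp only [r, Finset.mem_univ, true_and, Sum.elim_inr,
          Finset.mem_product, Finset.mem_singleton, and_true]
        exact eq_comm
      rw [this]
      simp
  have hS : ∀ s, (Finset.univ.filter fun x => r x s).card = 6 := by
    rintro ⟨⟨v, β⟩, i⟩
    have : (Finset.univ.filter fun x => r x ((v, β), i)) =
        (((nbrs F v).attach.image fun w =>
          ((⟨s(v, w.1), mem_nbrs.1 w.2⟩, β) : F.edgeSet × Bool)).disjSum
          (Finset.univ.image fun j => (⟨v, j⟩ : Σ v : V, Fin (6 - (nbrs F v).card)))) := by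
      ext x
      rcases x with ⟨⟨e, he⟩, γ⟩ | ⟨w, j⟩
      · simp only [Finset.mem_filter, Finset.mem_univ, true_and, Finset.inl_mem_disjSum,
          Finset.mem_image, Finset.mem_attach, Subtype.exists, Prod.mk.injEq,
          mem_nbrs, r, Sum.elim_inl]
        constructor
        · rintro ⟨rfl, hv⟩
          obtain ⟨w, rfl⟩ := hv
          exact ⟨w, he, rfl, rfl⟩
        · rintro ⟨w, hw, hwe, rfl⟩
          obtain rfl : s(v, w) = e := congrArg Subtype.val hwe
          simp
      · simp only [Finset.mem_filter, Finset.mem_univ, true_and, Finset.inr_mem_disjSum,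
          Finset.mem_image, r, Sum.elim_inr]
        constructor
        · rintro rfl
          exact ⟨j, rfl⟩
        · rintro ⟨k, hk⟩
          exact (congrArg Sigma.fst hk).symm
    rw [this, Finset.card_disjSum, Finset.card_image_of_injective, Finset.card_image_of_injective]
    · have := hF v
      simp
      omega
    · exact fun a b h => by simpa using h
    · rintro ⟨a, ha⟩ ⟨b, hb⟩ h
      have : s(v, a) = s(v, b) := congrArg (fun p => (p.1 : Sym2 V)) h
      exact Subtype.ext (Sym2.congr_right.1 this)
  obtain ⟨f, hf, hrf⟩ := exists_injective_of_degrees r (d := 6) (by norm_num)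
    (fun x => (hE x).ge) (fun s => (hS s).le)
  -- The reverse injection only serves to equate cardinalities and make `f` a bijection, so that
  -- each vertex owns exactly 3 of its 6 padded edges.
  obtain ⟨g, hg, -⟩ := exists_injective_of_degrees (fun s x => r x s) (d := 6) (by norm_num)
    (fun s => (hS s).ge) (fun x => (hE x).le)
  have hcard := le_antisymm (Fintype.card_le_of_injective f hf) (Fintype.card_le_of_injective g hg)
  have hbij : Function.Bijective f := (Fintype.bijective_iff_injective_and_card f).2 ⟨hf, hcard⟩
  -- In the copy labelled `false`, each edge leaves the end that owns it.
  obtain ⟨O, hO⟩ : ∃ O : V → V → Prop, ∀ u v, O u v ↔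
      ∃ h : F.Adj u v, (f (.inl (⟨s(u, v), h⟩, false))).1.1 = u := ⟨fun _ _ => _, fun _ _ => Iff.rfl⟩
  have hswap : ∀ u v (h : F.Adj u v),
      (⟨s(u, v), h⟩ : F.edgeSet) = ⟨s(v, u), h.symm⟩ := fun u v h => Subtype.ext Sym2.eq_swap
  refine ⟨O, ?_, ?_, ?_, ?_⟩
  · intro u v
    constructor
    · intro h
      rw [hO, hO]
      have := (hrf (.inl (⟨s(u, v), h⟩, false))).2
      rcases Sym2.mem_iff.1 this with h1 | h1
      · exact .inl ⟨h, h1⟩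
      · refine .inr ⟨h.symm, ?_⟩
        rw [← hswap u v h]
        exact h1
    · rw [hO, hO]
      rintro (⟨h, -⟩ | ⟨h, -⟩)
      · exact h
      · exact h.symm
  · intro u v
    rw [hO, hO]
    rintro ⟨h, h1⟩ ⟨h', h2⟩
    rw [← hswap u v h, h1] at h2
    exact h.ne h2
  · intro u
    let φ : V → Fin 3 := fun v => if h : F.Adj u v then (f (.inl (⟨s(u, v), h⟩, false))).2 else 0
    have : Set.InjOn φ (Finset.univ.filter fun v => O u v) := by
      intro v hv w hw hvw
      simp only [Finset.coe_filter, Finset.mem_univ, true_and, Set.mem_ofPred_eq, hO] at hv hw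
      obtain ⟨h, h1⟩ := hv
      obtain ⟨h', h1'⟩ := hw
      simp only [φ, h, h', dif_pos] at hvw
      have h2 := (hrf (.inl (⟨s(u, v), h⟩, false))).1
      have h2' := (hrf (.inl (⟨s(u, w), h'⟩, false))).1
      have := hf (Prod.ext (Prod.ext (h1.trans h1'.symm) (h2.symm.trans h2')) hvw)
      have h3 : s(u, v) = s(u, w) :=
        congrArg (fun p => (p.1 : Sym2 V)) (Sum.inl_injective this)
      exact Sym2.congr_right.1 h3
    exact Finset.card_le_card_of_injOn (t := (Finset.univ : Finset (Fin 3))) φ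
      (fun _ _ => by simp) this
  · intro v
    -- All three slots of `(v, false)` are filled, so at most 6 - 3 incident edges are owned
    -- elsewhere; these include all edges entering `v`.
    have h3 : 3 ≤ (Finset.univ.filter fun x => r x ((v, false), 0) ∧ (f x).1 = (v, false)).card := by
      let ψ : Fin 3 → PaddedEdge F := fun i => (Equiv.ofBijective f hbij).symm ((v, false), i)
      have hψ : ∀ i, f (ψ i) = ((v, false), i) := fun i =>
        (Equiv.ofBijective f hbij).apply_symm_apply _
      have hinj : Function.Injective ψ := fun i j h => by
        have := (hψ i).symm.trans ((congrArg f h).trans (hψ j))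
        simpa using this
      have := Finset.card_le_card_of_injOn (s := Finset.univ)
        (t := Finset.univ.filter fun x => r x ((v, false), 0) ∧ (f x).1 = (v, false)) ψ
        (fun i _ => by
          have := hrf (ψ i)
          rw [hψ] at this
          simp only [Finset.coe_filter, Finset.mem_univ, true_and, Set.mem_ofPred_eq, hψ, and_true]
          exact this) hinj.injOn
      simpa using this
    have h6 := hS ((v, false), 0)
    rw [← Finset.card_filter_add_card_filter_not (fun x => (f x).1 = (v, false)),
      Finset.filter_filter, Finset.filter_filter] at h6
    let φ : V → PaddedEdge F := fun u => if h : F.Adj u v then .inl (⟨s(u, v), h⟩, false) else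
      (Equiv.ofBijective f hbij).symm ((v, false), 0)
    refine (Finset.card_le_card_of_injOn (t := Finset.univ.filter fun x =>
      r x ((v, false), 0) ∧ ¬ (f x).1 = (v, false)) φ ?_ ?_).trans (by omega)
    · intro u hu
      simp only [Finset.coe_filter, Finset.mem_univ, true_and, Set.mem_ofPred_eq, hO] at hu ⊢
      obtain ⟨h, h1⟩ := hu
      simp only [φ, h, dif_pos]
      refine ⟨⟨rfl, Sym2.mem_mk_right u v⟩, fun h2 => h.ne ?_⟩
      rw [← h1, h2]
    · intro u hu w hw huw
      simp only [Finset.coe_filter, Finset.mem_univ, true_and, Set.mem_ofPred_eq, hO] at hu hw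
      obtain ⟨h, -⟩ := hu
      obtain ⟨h', -⟩ := hw
      simp only [φ, h, h', dif_pos] at huw
      have h3 : s(u, v) = s(w, v) :=
        congrArg (fun p => (p.1 : Sym2 V)) (Sum.inl_injective huw)
      exact Sym2.congr_left.1 h3

open Classical in
/-- A relation with row and column sums at most `3` contains a partial matching that meets every
row and every column of sum `3`. -/
lemma exists_partial_matching (O : V → V → Prop)
    (hout : ∀ u, (Finset.univ.filter fun v => O u v).card ≤ 3)
    (hin : ∀ v, (Finset.univ.filter fun u => O u v).card ≤ 3) :
    ∃ M : V → V → Prop, (∀ u v, M u v → O u v) ∧ (∀ u v w, M u v → M u w → v = w) ∧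
      (∀ u v w, M u w → M v w → u = v) ∧
      (∀ u, (Finset.univ.filter fun v => O u v).card = 3 → ∃ v, M u v) ∧
      (∀ v, (Finset.univ.filter fun u => O u v).card = 3 → ∃ u, M u v) := by
  let o : V → ℕ := fun u => (Finset.univ.filter fun v => O u v).card
  let i : V → ℕ := fun v => (Finset.univ.filter fun u => O u v).card
  -- The block matrix with `O` and its transpose on the diagonal and the row and column deficiencies
  -- off it has all line sums 3. A permutation in its support, restricted to the `O` block, is the
  -- matching; lines of sum 3 have no deficiency and must be met inside that block.
  let m : V ⊕ V → V ⊕ V → ℕ := fun x y => match x, y with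
    | .inl u, .inl v => if O u v then 1 else 0
    | .inl u, .inr v => if u = v then 3 - o u else 0
    | .inr u, .inl v => if u = v then 3 - i u else 0
    | .inr u, .inr v => if O v u then 1 else 0
  have hrow : ∀ x, ∑ y, m x y = 3 := by
    rintro (u | u)
    · have h := hout u
      simp only [Fintype.sum_sum_type, m, Finset.sum_ite_eq, Finset.mem_univ, if_true, o,
        ← Finset.card_filter]
      omega
    · have h := hin u
      simp only [Fintype.sum_sum_type, m, Finset.sum_ite_eq, Finset.mem_univ, if_true, i,
        ← Finset.card_filter]
      omega
  have hcol : ∀ y, ∑ x, m x y = 3 := by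
    rintro (u | u)
    · have h := hin u
      simp only [Fintype.sum_sum_type, m, Finset.sum_ite_eq', Finset.mem_univ, if_true, i,
        ← Finset.card_filter]
      omega
    · have h := hout u
      simp only [Fintype.sum_sum_type, m, Finset.sum_ite_eq', Finset.mem_univ, if_true, o,
        ← Finset.card_filter]
      omega
  obtain ⟨σ, hσ, hσm⟩ : ∃ σ : V ⊕ V → V ⊕ V, Function.Injective σ ∧ ∀ x, m x (σ x) ≠ 0 := by
    rw [← Fintype.all_card_le_filter_rel_iff_exists_injective (fun x y => m x y ≠ 0)]
    intro A
    -- Hall's condition: the rows in `A` carry total weight 3|A|, all of it in columns of weight 3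
    -- each.
    refine Nat.le_of_mul_le_mul_right (c := 3) ?_ (by norm_num)
    calc A.card * 3 = ∑ x ∈ A, ∑ y, m x y := by simp [hrow]
      _ = ∑ x ∈ A, ∑ y with ∃ a ∈ A, m a y ≠ 0, m x y := by
        refine Finset.sum_congr rfl fun x hx => (Finset.sum_filter_of_ne fun y _ hy => ?_).symm
        exact ⟨x, hx, hy⟩
      _ = ∑ y with ∃ a ∈ A, m a y ≠ 0, ∑ x ∈ A, m x y := Finset.sum_comm
      _ ≤ ∑ y with ∃ a ∈ A, m a y ≠ 0, 3 := by
        refine Finset.sum_le_sum fun y _ => ?_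
        rw [← hcol y]
        exact Finset.sum_le_univ_sum_of_nonneg fun _ => Nat.zero_le _
      _ = _ := by simp
  have hsurj := Finite.surjective_of_injective hσ
  refine ⟨fun u v => σ (.inl u) = .inl v, ?_, ?_, ?_, ?_, ?_⟩
  · intro u v h
    have := hσm (.inl u)
    rw [h] at this
    by_contra hO
    simp [m, hO] at this
  · intro u v w h1 h2
    exact Sum.inl_injective (h1.symm.trans h2)
  · intro u v w h1 h2
    exact Sum.inl_injective (hσ (h1.trans h2.symm))
  · intro u hu
    have := hσm (.inl u)
    rcases h : σ (.inl u) with v | v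
    · exact ⟨v, h⟩
    · rw [h] at this
      simp [m, o, hu] at this
  · intro v hv
    obtain ⟨x, hx⟩ := hsurj (.inl v)
    rcases x with u | u
    · exact ⟨u, hx⟩
    · have := hσm (.inr u)
      rw [hx] at this
      by_cases huv : u = v
      · subst huv
        simp [m, i, hv] at this
      · simp [m, huv] at this

/-- A graph of maximum degree at most `6` splits into graphs of maximum degree at most `4`
and `2`. -/
theorem exists_split_four_two (F : SimpleGraph V) (hF : ∀ v, (nbrs F v).card ≤ 6) :
    ∃ R B : SimpleGraph V, F ≤ R ⊔ B ∧ (∀ v, (nbrs R v).card ≤ 4) ∧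
      ∀ v, (nbrs B v).card ≤ 2 := by
  classical
  obtain ⟨O, hO, hanti, hout, hin⟩ := exists_balanced_orientation F hF
  obtain ⟨M, hMO, hM1, hM2, hM3, hM4⟩ := exists_partial_matching O hout hin
  have hne : ∀ u, ¬ O u u := fun u h => hanti u u h h
  let R : SimpleGraph V :=
    { Adj := fun u v => (O u v ∧ ¬ M u v) ∨ (O v u ∧ ¬ M v u)
      symm := ⟨fun _ _ h => h.symm⟩
      loopless := ⟨fun u h => by rcases h with h | h <;> exact hne u h.1⟩ }
  let B : SimpleGraph V :=
    { Adj := fun u v => M u v ∨ M v u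
      symm := ⟨fun _ _ h => h.symm⟩
      loopless := ⟨fun u h => by rcases h with h | h <;> exact hne u (hMO _ _ h)⟩ }
  -- Removing the matching lowers every out- or in-degree equal to 3. Hence `R` has degrees at most
  -- 2 + 2, and `B`, the matching itself, at most 1 + 1.
  have hle : ∀ (p q : V → Prop) [DecidablePred p] [DecidablePred q] (k : ℕ),
      (Finset.univ.filter p).card ≤ k + 1 → (∀ v, q v → p v) →
      ((Finset.univ.filter p).card = k + 1 → ∃ v, p v ∧ ¬ q v) →
      (Finset.univ.filter q).card ≤ k := by
    intro p q _ _ k h1 h2 h3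
    have hsub : Finset.univ.filter q ⊆ Finset.univ.filter p := fun v => by simpa using h2 v
    rcases h1.lt_or_eq with h | h
    · exact (Finset.card_le_card hsub).trans (by omega)
    · obtain ⟨v, hv, hv'⟩ := h3 h
      have := Finset.card_lt_card (Finset.ssubset_iff_subset_ne.2 ⟨hsub, fun he => hv' (by
        have : v ∈ Finset.univ.filter q := he ▸ (by simpa using hv)
        simpa using this)⟩)
      omega
  refine ⟨R, B, ?_, ?_, ?_⟩
  · intro u v h
    rcases (hO u v).1 h with h | h
    · by_cases hm : M u v
      · exact .inr (.inl hm)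
      · exact .inl (.inl ⟨h, hm⟩)
    · by_cases hm : M v u
      · exact .inr (.inr hm)
      · exact .inl (.inr ⟨h, hm⟩)
  · intro u
    have h1 : (Finset.univ.filter fun v => O u v ∧ ¬ M u v).card ≤ 2 := by
      refine hle (fun v => O u v) _ 2 (hout u) (fun v h => h.1) fun h => ?_
      obtain ⟨v, hv⟩ := hM3 u h
      exact ⟨v, hMO _ _ hv, fun h => h.2 hv⟩
    have h2 : (Finset.univ.filter fun v => O v u ∧ ¬ M v u).card ≤ 2 := by
      refine hle (fun v => O v u) _ 2 (hin u) (fun v h => h.1) fun h => ?_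
      obtain ⟨v, hv⟩ := hM4 u h
      exact ⟨v, hMO _ _ hv, fun h => h.2 hv⟩
    refine (Finset.card_le_card (t := _ ∪ _) fun v hv => ?_).trans
      ((Finset.card_union_le _ _).trans (add_le_add h1 h2))
    have : R.Adj u v := mem_nbrs.1 hv
    simpa [R] using this
  · intro u
    have h1 : (Finset.univ.filter fun v => M u v).card ≤ 1 :=
      Finset.card_le_one.2 fun a ha b hb => hM1 u a b (by simpa using ha) (by simpa using hb)
    have h2 : (Finset.univ.filter fun v => M v u).card ≤ 1 :=
      Finset.card_le_one.2 fun a ha b hb => hM2 a b u (by simpa using ha) (by simpa using hb)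
    refine (Finset.card_le_card (t := _ ∪ _) fun v hv => ?_).trans
      ((Finset.card_union_le _ _).trans (add_le_add h1 h2))
    have : B.Adj u v := mem_nbrs.1 hv
    simpa [B] using this

end Splitting

/-! ### Critical graphs -/

section Critical

variable {V : Type*}

/-- The target of the first colour. -/
abbrev redTarget : SimpleGraph ((Fin 1 ⊕ Fin 5) ⊕ (Fin 1 ⊕ Fin 2)) := starG 5 ⊕g starG 2

/-- The target of the second colour. -/
abbrev blueTarget : SimpleGraph ((Fin 1 ⊕ Fin 3) ⊕ (Fin 122 × Bool)) := starG 3 ⊕g matchingG 122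

/-- The consequences of Ramsey-minimality for the two targets that bound the order of a graph;
colourings are given by two colour classes that cover the edges. -/
structure IsCritical (F : SimpleGraph V) : Prop where
  arrows : ∀ R B : SimpleGraph V, F ≤ R ⊔ B →
    redTarget.IsContained R ∨ blueTarget.IsContained B
  deletion : ∀ s t, F.Adj s t → ∃ R B : SimpleGraph V, ¬ redTarget.IsContained R ∧
    ¬ blueTarget.IsContained B ∧ F ≤ R ⊔ B ⊔ edge s t
  no_isolated : ∀ v, ∃ w, F.Adj v w

lemma redTarget_isContained_iff [DecidableEq V] {R : SimpleGraph V} :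
    redTarget.IsContained R ↔ ∃ (c : V) (A : Finset V) (d y z : V), A.card = 5 ∧
      (∀ a ∈ A, R.Adj c a) ∧ R.Adj d y ∧ R.Adj d z ∧ y ≠ z ∧
      d ∉ insert c A ∧ y ∉ insert c A ∧ z ∉ insert c A := by
  rw [starG_sum_isContained_iff]
  simp only [hasCopyAvoiding_starG_iff]
  constructor
  · rintro ⟨c, A, hA, hadj, d, D, hD, hd, hdc, hDc⟩
    obtain ⟨y, z, hyz, rfl⟩ := Finset.card_eq_two.1 hD
    exact ⟨c, A, d, y, z, hA, hadj, hd _ (by simp), hd _ (by simp), hyz, hdc, hDc _ (by simp),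
      hDc _ (by simp)⟩
  · rintro ⟨c, A, d, y, z, hA, hadj, hy, hz, hyz, h1, h2, h3⟩
    refine ⟨c, A, hA, hadj, d, {y, z}, Finset.card_pair hyz, ?_, h1, ?_⟩
    · simp [hy, hz]
    · simp only [Finset.mem_insert, Finset.mem_singleton, forall_eq_or_imp, forall_eq] at h2 h3 ⊢
      exact ⟨h2, h3⟩

lemma adj_of_sup_edge_adj {X : SimpleGraph V} {s t a b : V} (h : (X ⊔ edge s t).Adj a b)
    (ha : a ≠ s) (hb : b ≠ s) : X.Adj a b := by
  rcases h with h | h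
  · exact h
  · rw [edge_adj] at h
    tauto

/-- Away from the deleted edge, every edge keeps a colour. -/
lemma adj_or_adj_of_le {F R B : SimpleGraph V} {s t a b : V} (h : F ≤ R ⊔ B ⊔ edge s t)
    (hab : F.Adj a b) (ha : a ≠ s) (ha' : a ≠ t) : R.Adj a b ∨ B.Adj a b := by
  rcases h hab with h | h
  · exact h
  · rw [edge_adj] at h
    tauto

/-- No component of a critical graph is a single edge. -/
lemma IsCritical.exists_third {F : SimpleGraph V} (hF : IsCritical F) {x y : V}
    (hxy : F.Adj x y) : ∃ z, z ≠ x ∧ z ≠ y ∧ (F.Adj x z ∨ F.Adj y z) := by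
  classical
  by_contra! hno
  obtain ⟨R, B, hR, hB, hle⟩ := hF.deletion x y hxy
  -- An isolated edge can be returned in red, as it lies in no star with two edges. Intersecting
  -- with `F` is needed because colour classes may contain edges outside `F`.
  let X : SimpleGraph V := R ⊓ F ⊔ edge x y
  have hXF : X ≤ F := sup_le inf_le_right ((edge_le_iff F).2 (.inr hxy))
  have hXR : ∀ u a b, X.Adj u a → X.Adj u b → a ≠ b → ∀ w, X.Adj u w → R.Adj u w := by
    intro u a b ha hb hab w hw
    have hux : u ≠ x := by
      rintro rfl
      have hy : ∀ z, F.Adj u z → z = y := fun z hz => by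
        by_contra h
        exact (hno z hz.ne' h).1 hz
      exact hab ((hy a (hXF ha)).trans (hy b (hXF hb)).symm)
    have huy : u ≠ y := by
      rintro rfl
      have hx : ∀ z, F.Adj u z → z = x := fun z hz => by
        by_contra h
        exact (hno z h hz.ne').2 hz
      exact hab ((hx a (hXF ha)).trans (hx b (hXF hb)).symm)
    rcases hw with hw | hw
    · exact hw.1
    · rw [edge_adj] at hw
      tauto
  have hle' : F ≤ X ⊔ B := by
    intro a b hab
    rcases hle hab with (h | h) | h
    · exact .inl (.inl ⟨h, hab⟩)
    · exact .inr h
    · exact .inl (.inr h)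
  rcases hF.arrows X B hle' with h | h
  · obtain ⟨c, A, d, y, z, hA, hadj, hdy, hdz, hyz, hd⟩ := redTarget_isContained_iff.1 h
    obtain ⟨a, ha, b, hb, hab⟩ := Finset.one_lt_card.1 (by omega : 1 < A.card)
    have hc := hXR c a b (hadj a ha) (hadj b hb) hab
    have hd' := hXR d y z hdy hdz hyz
    exact hR (redTarget_isContained_iff.2 ⟨c, A, d, y, z, hA, fun a ha => hc a (hadj a ha),
      hd' y hdy, hd' z hdz, hyz, hd⟩)
  · exact hB h

lemma card_le_card_sdiff_pair_add_two [DecidableEq V] (Q : Finset V) (s t : V) :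
    Q.card ≤ (Q \ {s, t}).card + 2 := by
  have h1 := Finset.le_card_sdiff {s, t} Q
  have h2 : ({s, t} : Finset V).card ≤ 2 := Finset.card_le_two
  omega

lemma exists_finset_mem {W : Type*} [Fintype W] (g : W → V) :
    ∃ I : Finset V, I.card ≤ Fintype.card W ∧ ∀ w, g w ∈ I := by
  classical
  exact ⟨Finset.univ.image g, Finset.card_image_le, fun w => by simp⟩

/-! ### Bounded degree -/

variable [Fintype V]

lemma exists_adj_adj_of_three_le {X : SimpleGraph V} {v x : V} (h : 3 ≤ (nbrs X v).card) :
    ∃ y z, X.Adj v y ∧ X.Adj v z ∧ y ≠ z ∧ y ≠ x ∧ z ≠ x := by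
  classical
  have : 1 < ((nbrs X v).erase x).card := by
    have := Finset.pred_card_le_card_erase (s := nbrs X v) (a := x)
    omega
  obtain ⟨y, hy, z, hz, hyz⟩ := Finset.one_lt_card.1 this
  simp only [Finset.mem_erase, mem_nbrs] at hy hz
  exact ⟨y, z, hy.2, hz.2, hyz, hy.1, hz.1⟩

/-- A red S(2) avoiding `v` blocks at most 3 neighbours of `v`, leaving 5 for a disjoint S(5). So
`R` minus `v` is a matching plus isolated vertices. -/
lemma eq_of_adj_of_large_red_degree {R : SimpleGraph V} (hR : ¬ redTarget.IsContained R) {v : V}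
    (hv : 8 ≤ (nbrs R v).card) {d y z : V} (hd : d ≠ v) (hy : y ≠ v) (hz : z ≠ v)
    (hdy : R.Adj d y) (hdz : R.Adj d z) : y = z := by
  classical
  by_contra hyz
  have h5 : 5 ≤ (nbrs R v \ {d, y, z}).card := by
    have h1 := Finset.le_card_sdiff {d, y, z} (nbrs R v)
    have h2 : ({d, y, z} : Finset V).card ≤ 3 := Finset.card_le_three
    omega
  obtain ⟨A, hA, hA5⟩ := Finset.exists_subset_card_eq h5
  refine hR (redTarget_isContained_iff.2 ⟨v, A, d, y, z, hA5, fun a ha => ?_, hdy, hdz, hyz, ?_⟩)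
  · have := hA ha
    simp only [Finset.mem_sdiff, mem_nbrs] at this
    exact this.1
  · have hn : ∀ x ∈ ({d, y, z} : Finset V), x ∉ A := fun x hx hxA =>
      (Finset.mem_sdiff.1 (hA hxA)).2 hx
    simp only [Finset.mem_insert, not_or]
    exact ⟨⟨hd, hn _ (by simp)⟩, ⟨hy, hn _ (by simp)⟩, ⟨hz, hn _ (by simp)⟩⟩

/-- One of the two stars of the target would leave an S(2) avoiding `v`, hence untouched by the new
edge. -/
lemma redTarget_free_sup_edge {R : SimpleGraph V} (hR : ¬ redTarget.IsContained R) {v : V}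
    (hv : 8 ≤ (nbrs R v).card) (w : V) : ¬ redTarget.IsContained (R ⊔ edge v w) := by
  classical
  rw [redTarget_isContained_iff]
  rintro ⟨c, A, d, y, z, hA, hadj, hdy, hdz, hyz, hd, hy, hz⟩
  by_cases hcv : c = v
  · subst hcv
    simp only [Finset.mem_insert, not_or] at hd hy hz
    exact hyz (eq_of_adj_of_large_red_degree hR hv hd.1 hy.1 hz.1
      (adj_of_sup_edge_adj hdy hd.1 hy.1) (adj_of_sup_edge_adj hdz hd.1 hz.1))
  · have : 1 < (A.erase v).card := by
      have := Finset.pred_card_le_card_erase (s := A) (a := v)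
      omega
    obtain ⟨a, ha, b, hb, hab⟩ := Finset.one_lt_card.1 this
    rw [Finset.mem_erase] at ha hb
    exact hab (eq_of_adj_of_large_red_degree hR hv hcv ha.1 hb.1
      (adj_of_sup_edge_adj (hadj a ha.2) hcv ha.1) (adj_of_sup_edge_adj (hadj b hb.2) hcv hb.1))

/-- A new target contains 123K₂, hence 122K₂ avoiding `v` and so lying in `B`. It occupies 244
vertices, which leaves `v` at least 3 neighbours for a disjoint star. -/
lemma blueTarget_free_sup_edge {B : SimpleGraph V} (hB : ¬ blueTarget.IsContained B) {v : V}
    (hv : 248 ≤ (nbrs B v).card) (w : V) : ¬ blueTarget.IsContained (B ⊔ edge v w) := by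
  classical
  intro h
  obtain ⟨g, hg⟩ := hasCopyAvoiding_matchingG_of_succ (k := 122)
    (matchingG_isContained_of_star (r := 2) h) v
  simp only [Finset.mem_singleton] at hg
  obtain ⟨I, hIcard, hI⟩ := exists_finset_mem g
  have h3 : 3 ≤ (nbrs B v \ I).card := by
    have h1 := Finset.le_card_sdiff I (nbrs B v)
    have h2 : I.card ≤ 244 := hIcard.trans (by simp)
    omega
  obtain ⟨A, hA, hA3⟩ := Finset.exists_subset_card_eq h3
  refine hB (starG_sum_isContained_iff.2 ⟨v, A, hA3, fun a ha => ?_,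
    ⟨⟨g, fun {p q} hpq => ?_⟩, g.injective⟩, fun p hp => ?_⟩)
  · exact mem_nbrs.1 (Finset.mem_sdiff.1 (hA ha)).1
  · exact adj_of_sup_edge_adj (g.toHom.map_adj hpq) (hg p) (hg q)
  · rcases Finset.mem_insert.1 hp with hp | hp
    · exact hg p hp
    · exact (Finset.mem_sdiff.1 (hA hp)).2 (hI p)

lemma IsCritical.card_nbrs_le {F : SimpleGraph V} (hF : IsCritical F) (v : V) :
    (nbrs F v).card ≤ 255 := by
  classical
  by_contra! h
  obtain ⟨w, hw⟩ := hF.no_isolated v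
  obtain ⟨R, B, hR, hB, hle⟩ := hF.deletion v w hw
  have h1 := card_nbrs_le_add hle v
  have h2 := card_nbrs_le_add (le_refl (R ⊔ B)) v
  have h3 : (nbrs (edge v w) v).card ≤ 1 := by
    refine (Finset.card_le_card (t := {w}) fun x hx => ?_).trans (by simp)
    rw [mem_nbrs, edge_adj] at hx
    rw [Finset.mem_singleton]
    rcases hx with ⟨h | h, -⟩
    · exact h.2
    · exact h.2.trans h.1
  -- Without `vw`, at least 255 = 7 + 248 edges at `v` are coloured, so red degree at most 7 forces
  -- blue degree at least 248.
  rcases le_or_gt 8 (nbrs R v).card with h8 | h8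
  · rcases hF.arrows (R ⊔ edge v w) B (by rwa [sup_right_comm]) with h | h
    · exact redTarget_free_sup_edge hR h8 w h
    · exact hB h
  · rcases hF.arrows R (B ⊔ edge v w) (by rwa [← sup_assoc]) with h | h
    · exact hR h
    · exact blueTarget_free_sup_edge hB (by omega) w h

/-- The closed neighbourhood of a set of vertices. -/
noncomputable def closedNbhd (F : SimpleGraph V) (U : Finset V) : Finset V := by
  classical exact U ∪ U.biUnion (nbrs F)

lemma subset_closedNbhd (F : SimpleGraph V) (U : Finset V) : U ⊆ closedNbhd F U := by
  classical exact Finset.subset_union_left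

lemma mem_closedNbhd_of_adj {F : SimpleGraph V} {U : Finset V} {u v : V} (hu : u ∈ U)
    (h : F.Adj v u) : v ∈ closedNbhd F U := by
  classical
  exact Finset.mem_union_right _ (Finset.mem_biUnion.2 ⟨u, hu, mem_nbrs.2 h.symm⟩)

lemma IsCritical.card_closedNbhd_le {F : SimpleGraph V} (hF : IsCritical F) (U : Finset V) :
    (closedNbhd F U).card ≤ 256 * U.card := by
  classical
  refine (Finset.card_union_le _ _).trans ?_
  have := Finset.card_biUnion_le_card_mul U (nbrs F) 255 fun v _ => hF.card_nbrs_le v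
  omega

/-! ### Vertices of high degree -/

/-- The vertices of degree at least `5`. -/
noncomputable def highVerts (F : SimpleGraph V) : Finset V :=
  Finset.univ.filter fun v => 5 ≤ (nbrs F v).card

lemma mem_highVerts {F : SimpleGraph V} {v : V} : v ∈ highVerts F ↔ 5 ≤ (nbrs F v).card := by
  simp [highVerts]

lemma redTarget_free_of_degree_le {R : SimpleGraph V} (h : ∀ v, (nbrs R v).card ≤ 4) :
    ¬ redTarget.IsContained R := by
  classical
  rw [redTarget_isContained_iff]
  rintro ⟨c, A, -, -, -, hA, hadj, -⟩
  have := Finset.card_le_card (fun a ha => mem_nbrs.2 (hadj a ha) : A ⊆ nbrs R c)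
  have := h c
  omega

lemma blueTarget_free_of_degree_le {B : SimpleGraph V} (h : ∀ v, (nbrs B v).card ≤ 2) :
    ¬ blueTarget.IsContained B := by
  classical
  rw [starG_sum_isContained_iff]
  rintro ⟨c, A, hA, hadj, -⟩
  have := Finset.card_le_card (fun a ha => mem_nbrs.2 (hadj a ha) : A ⊆ nbrs B c)
  have := h c
  omega

lemma IsCritical.exists_seven_le {F : SimpleGraph V} (hF : IsCritical F) :
    ∃ x, 7 ≤ (nbrs F x).card := by
  by_contra! h
  obtain ⟨R, B, hle, hR, hB⟩ := exists_split_four_two F fun v => Nat.le_of_lt_succ (h v)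
  rcases hF.arrows R B hle with h | h
  · exact redTarget_free_of_degree_le hR h
  · exact blueTarget_free_of_degree_le hB h

/-- Otherwise, colour blue exactly the edges that meet a high vertex. Red degrees are at most 4, and
at most 122 vertices cover the blue edges, excluding the 123K₂ inside the blue target. -/
lemma IsCritical.card_highVerts {F : SimpleGraph V} (hF : IsCritical F) :
    123 ≤ (highVerts F).card := by
  classical
  by_contra! h
  let R : SimpleGraph V :=
    { Adj := fun u v => F.Adj u v ∧ u ∉ highVerts F ∧ v ∉ highVerts F
      symm := ⟨fun _ _ h => ⟨h.1.symm, h.2.2, h.2.1⟩⟩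
      loopless := ⟨fun _ h => h.1.ne rfl⟩ }
  let B : SimpleGraph V :=
    { Adj := fun u v => F.Adj u v ∧ (u ∈ highVerts F ∨ v ∈ highVerts F)
      symm := ⟨fun _ _ h => ⟨h.1.symm, h.2.symm⟩⟩
      loopless := ⟨fun _ h => h.1.ne rfl⟩ }
  have hle : F ≤ R ⊔ B := fun u v huv => by
    change (F.Adj u v ∧ _) ∨ (F.Adj u v ∧ _)
    tauto
  rcases hF.arrows R B hle with h' | h'
  · refine redTarget_free_of_degree_le (fun v => ?_) h'
    by_cases hv : v ∈ highVerts F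
    · have : nbrs R v = ∅ := Finset.eq_empty_of_forall_notMem fun w hw =>
        (mem_nbrs.1 hw).2.1 hv
      simp [this]
    · have : nbrs R v ⊆ nbrs F v := fun w hw => mem_nbrs.2 (mem_nbrs.1 hw).1
      have := Finset.card_le_card this
      rw [mem_highVerts] at hv
      omega
  · have hc : ∀ a b, B.Adj a b → a ∈ highVerts F ∨ b ∈ highVerts F := fun a b hab => hab.2
    exact not_matchingG_isContained_of_cover h hc
      (matchingG_isContained_of_star (r := 2) (k := 122) h')

lemma exists_cover_of_blueTarget_free {B : SimpleGraph V} (hB : ¬ blueTarget.IsContained B)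
    {v : V} (hv : 3 ≤ (nbrs B v).card) :
    ∃ Y : Finset V, Y.card ≤ 248 ∧ ∀ a b, B.Adj a b → a ∈ Y ∨ b ∈ Y := by
  classical
  obtain ⟨A, hA, hA3⟩ := Finset.exists_subset_card_eq hv
  rcases hasCopyAvoiding_matchingG_or_cover B 122 (insert v A) with h | ⟨Y, hY, hc⟩
  · exact absurd (starG_sum_isContained_iff.2 ⟨v, A, hA3, fun a ha => mem_nbrs.1 (hA ha), h⟩) hB
  · refine ⟨Y, ?_, hc⟩
    have := Finset.card_insert_le v A
    omega

/-- A graph without `S(5) ∪ S(2)` that contains `S(5)` has few vertices of degree at least `3`. -/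
lemma card_le_of_red_star {R : SimpleGraph V} (hR : ¬ redTarget.IsContained R) {c : V}
    (hc : 5 ≤ (nbrs R c).card) {Q : Finset V} (hQ : ∀ q ∈ Q, 3 ≤ (nbrs R q).card) :
    Q.card ≤ 48 := by
  classical
  by_cases h8 : ∃ v, 8 ≤ (nbrs R v).card
  · obtain ⟨v, hv⟩ := h8
    have : Q ⊆ {v} := fun q hq => by
      rw [Finset.mem_singleton]
      by_contra hqv
      obtain ⟨y, z, hy, hz, hyz, hyv, hzv⟩ := exists_adj_adj_of_three_le (x := v) (hQ q hq)
      exact hyz (eq_of_adj_of_large_red_degree hR hv hqv hyv hzv hy hz)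
    exact (Finset.card_le_card this).trans (by simp)
  · push Not at h8
    obtain ⟨A, hA, hA5⟩ := Finset.exists_subset_card_eq hc
    have hT : (insert c A).card ≤ 6 := (Finset.card_insert_le _ _).trans (by omega)
    have hsub : Q ⊆ insert c A ∪ (insert c A).biUnion (nbrs R) := fun q hq => by
      by_contra hn
      rw [Finset.mem_union, not_or, Finset.mem_biUnion] at hn
      have hout : ∀ y, R.Adj q y → y ∉ insert c A := fun y hy hyT =>
        hn.2 ⟨y, hyT, mem_nbrs.2 hy.symm⟩
      obtain ⟨y, z, hy, hz, hyz, -, -⟩ := exists_adj_adj_of_three_le (x := c) (hQ q hq)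
      exact hR (redTarget_isContained_iff.2 ⟨c, A, q, y, z, hA5, fun a ha => mem_nbrs.1 (hA ha),
        hy, hz, hyz, hn.1, hout y hy, hout z hz⟩)
    -- With red degrees at most 7, the 6 vertices of the star and their neighbours number at most 6
    -- + 6 · 7 = 48.
    have h1 := Finset.card_le_card hsub
    have h2 := Finset.card_union_le (insert c A) ((insert c A).biUnion (nbrs R))
    have h3 := Finset.card_biUnion_le_card_mul (insert c A) (nbrs R) 7
      fun v _ => Nat.le_of_lt_succ (h8 v)
    omega

/-! ### Bounding the order -/

lemma card_nbrs_le_add_of_ne {F R B : SimpleGraph V} {s t v : V} (h : F ≤ R ⊔ B ⊔ edge s t)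
    (hs : v ≠ s) (ht : v ≠ t) : (nbrs F v).card ≤ (nbrs R v).card + (nbrs B v).card := by
  classical
  refine (Finset.card_le_card fun w hw => ?_).trans (Finset.card_union_le _ _)
  simpa using adj_or_adj_of_le h (mem_nbrs.1 hw) hs ht

lemma IsCritical.red_degree_le {F : SimpleGraph V} (hF : IsCritical F)
    (hV : 256 ^ 4 < Fintype.card V) {R B : SimpleGraph V} {s t : V}
    (hR : ¬ redTarget.IsContained R) (hB : ¬ blueTarget.IsContained B)
    (hle : F ≤ R ⊔ B ⊔ edge s t) (c : V) : (nbrs R c).card ≤ 4 := by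
  classical
  by_contra! hc
  have hB2 : ∀ v, (nbrs B v).card ≤ 2 := by
    intro v
    by_contra! hv
    obtain ⟨Y, hY, hcov⟩ := exists_cover_of_blueTarget_free hB hv
    obtain ⟨A, hA, hA5⟩ := Finset.exists_subset_card_eq hc
    -- Red S(5), blue cover and deleted edge: 6 + 248 + 2 = 256 vertices, outside which every edge
    -- is red.
    let W : Finset V := (insert c A ∪ Y) ∪ {s, t}
    have hW : W.card ≤ 256 := by
      change ((insert c A ∪ Y) ∪ {s, t}).card ≤ 256
      have h1 := Finset.card_union_le (insert c A ∪ Y) {s, t}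
      have h2 := Finset.card_union_le (insert c A) Y
      have h3 := Finset.card_insert_le c A
      have h4 : ({s, t} : Finset V).card ≤ 2 := Finset.card_le_two
      omega
    have hred : ∀ a b, F.Adj a b → a ∉ W → b ∉ W → R.Adj a b := by
      intro a b hab ha hb
      simp only [W, Finset.mem_union, not_or, Finset.mem_insert, Finset.mem_singleton] at ha hb
      rcases adj_or_adj_of_le hle hab ha.2.1 ha.2.2 with h | h
      · exact h
      · rcases hcov a b h with h | h
        · exact absurd h ha.1.2
        · exact absurd h hb.1.2
    have hT : ∀ x, x ∉ W → x ∉ insert c A := fun x hx h =>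
      hx (Finset.mem_union_left _ (Finset.mem_union_left _ h))
    -- A vertex beyond the third neighbourhood lies in a three-vertex path of `F` that avoids `W`: a
    -- red S(2) disjoint from the S(5). Each neighbourhood costs a factor 256, whence 256^4.
    have huniv : Finset.univ ⊆ closedNbhd F (closedNbhd F (closedNbhd F W)) := by
      intro z _
      by_contra hz
      obtain ⟨y, hzy⟩ := hF.no_isolated z
      obtain ⟨x, hxz, hxy, hx⟩ := hF.exists_third hzy
      have hy2 : y ∉ closedNbhd F (closedNbhd F W) := fun h => hz (mem_closedNbhd_of_adj h hzy)
      have hz2 : z ∉ closedNbhd F (closedNbhd F W) := fun h => hz (subset_closedNbhd _ _ h)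
      have hx1 : x ∉ closedNbhd F W := fun h => by
        rcases hx with hx | hx
        · exact hz2 (mem_closedNbhd_of_adj h hx)
        · exact hy2 (mem_closedNbhd_of_adj h hx)
      have hyW : y ∉ W := fun h => hy2 (subset_closedNbhd _ _ (subset_closedNbhd _ _ h))
      have hzW : z ∉ W := fun h => hz2 (subset_closedNbhd _ _ (subset_closedNbhd _ _ h))
      have hxW : x ∉ W := fun h => hx1 (subset_closedNbhd _ _ h)
      have hcA : ∀ a ∈ A, R.Adj c a := fun a ha => mem_nbrs.1 (hA ha)
      refine hR (redTarget_isContained_iff.2 ?_)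
      rcases hx with hx | hx
      · exact ⟨c, A, z, y, x, hA5, hcA, hred _ _ hzy hzW hyW, hred _ _ hx hzW hxW, hxy.symm,
          hT _ hzW, hT _ hyW, hT _ hxW⟩
      · exact ⟨c, A, y, z, x, hA5, hcA, hred _ _ hzy.symm hyW hzW, hred _ _ hx hyW hxW, hxz.symm,
          hT _ hyW, hT _ hzW, hT _ hxW⟩
    have h0 := Finset.card_le_card huniv
    rw [Finset.card_univ] at h0
    have h1 := hF.card_closedNbhd_le W
    have h2 := hF.card_closedNbhd_le (closedNbhd F W)
    have h3 := hF.card_closedNbhd_le (closedNbhd F (closedNbhd F W))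
    norm_num at hV
    omega
  -- Degree at least 5 with blue degree at most 2 leaves red degree at least 3. Then 48 + 2 < 123 is
  -- the contradiction.
  have hQ := card_le_of_red_star hR hc (Q := highVerts F \ {s, t}) fun q hq => by
    simp only [Finset.mem_sdiff, mem_highVerts, Finset.mem_insert, Finset.mem_singleton,
      not_or] at hq
    have h1 := card_nbrs_le_add_of_ne hle hq.2.1 hq.2.2
    have h2 := hB2 q
    omega
  have h1 := hF.card_highVerts
  have h2 := card_le_card_sdiff_pair_add_two (highVerts F) s t
  omega

lemma IsCritical.mem_highVerts_of_adj {F : SimpleGraph V} (hF : IsCritical F)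
    (hV : 256 ^ 4 < Fintype.card V) {s t : V} (hst : F.Adj s t) :
    s ∈ highVerts F ∨ t ∈ highVerts F := by
  classical
  by_contra! h
  rw [mem_highVerts, mem_highVerts] at h
  obtain ⟨R, B, hR, hB, hle⟩ := hF.deletion s t hst
  have hdeg := hF.red_degree_le hV hR hB hle
  -- With `st` returned in red, the ends keep red degree at most 4 because their degree in `F` is at
  -- most 4; this is why `R` is cut down to `F`.
  have hle' : F ≤ ((R ⊓ F) ⊔ edge s t) ⊔ B := by
    intro a b hab
    rcases hle hab with (h | h) | h
    · exact .inl (.inl ⟨h, hab⟩)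
    · exact .inr h
    · exact .inl (.inr h)
  rcases hF.arrows _ _ hle' with h' | h'
  · refine redTarget_free_of_degree_le (fun v => ?_) h'
    by_cases hv : v = s ∨ v = t
    · have : nbrs ((R ⊓ F) ⊔ edge s t) v ⊆ nbrs F v := fun w hw => by
        rw [mem_nbrs] at hw ⊢
        rcases hw with hw | hw
        · exact hw.2
        · rw [edge_adj] at hw
          rcases hw with ⟨⟨rfl, rfl⟩ | ⟨rfl, rfl⟩, -⟩
          · exact hst
          · exact hst.symm
      have := Finset.card_le_card this
      rcases hv with rfl | rfl <;> omega
    · have : nbrs ((R ⊓ F) ⊔ edge s t) v ⊆ nbrs R v := fun w hw => by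
        rw [mem_nbrs] at hw ⊢
        rcases hw with hw | hw
        · exact hw.1
        · rw [edge_adj] at hw
          tauto
      exact (Finset.card_le_card this).trans (hdeg v)
  · exact hB h'

theorem IsCritical.card_le {F : SimpleGraph V} (hF : IsCritical F) :
    Fintype.card V ≤ 256 ^ 4 := by
  classical
  by_contra! hV
  obtain ⟨x, hx⟩ := hF.exists_seven_le
  obtain ⟨s, t, hst, hs, ht⟩ : ∃ s t, F.Adj s t ∧ x ≠ s ∧ x ≠ t := by
    -- If every edge contained `x`, the graph would be a star with at most 256 vertices.
    by_contra! hno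
    have huniv : Finset.univ ⊆ closedNbhd F {x} := fun z _ => by
      obtain ⟨y, hy⟩ := hF.no_isolated z
      by_cases hz : x = z
      · exact subset_closedNbhd _ _ (by simp [hz])
      · exact mem_closedNbhd_of_adj (u := y) (by simp [hno z y hy hz]) hy
    have h0 := Finset.card_le_card huniv
    rw [Finset.card_univ] at h0
    have h1 := hF.card_closedNbhd_le {x}
    simp only [Finset.card_singleton] at h1
    norm_num at hV
    omega
  obtain ⟨R, B, hR, hB, hle⟩ := hF.deletion s t hst
  have hdeg := hF.red_degree_le hV hR hB hle
  obtain ⟨Y, hY, hcov⟩ := exists_cover_of_blueTarget_free hB (v := x) (by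
    have h1 := card_nbrs_le_add_of_ne hle hs ht
    have h2 := hdeg x
    omega)
  -- Red degree at most 4 forces a blue edge at every high vertex other than `s` and `t`, and `Y`
  -- meets that edge.
  have hsub : highVerts F ⊆ closedNbhd F Y ∪ {s, t} := by
    intro q hq
    by_contra hn
    simp only [Finset.mem_union, not_or, Finset.mem_insert, Finset.mem_singleton] at hn
    rw [mem_highVerts] at hq
    obtain ⟨w, hw, hwR⟩ := Finset.exists_mem_notMem_of_card_lt_card
      (show (nbrs R q).card < (nbrs F q).card from (hdeg q).trans_lt hq)
    rw [mem_nbrs] at hw hwR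
    have hqw := (adj_or_adj_of_le hle hw hn.2.1 hn.2.2).resolve_left hwR
    rcases hcov q w hqw with h | h
    · exact hn.1 (subset_closedNbhd _ _ h)
    · exact hn.1 (mem_closedNbhd_of_adj h hw)
  have huniv : Finset.univ ⊆ closedNbhd F (highVerts F) := fun z _ => by
    obtain ⟨y, hy⟩ := hF.no_isolated z
    rcases hF.mem_highVerts_of_adj hV hy with h | h
    · exact subset_closedNbhd _ _ h
    · exact mem_closedNbhd_of_adj h hy
  have h0 := Finset.card_le_card huniv
  rw [Finset.card_univ] at h0
  have h1 := hF.card_closedNbhd_le (highVerts F)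
  have h2 := Finset.card_le_card hsub
  have h3 := Finset.card_union_le (closedNbhd F Y) {s, t}
  have h4 : ({s, t} : Finset V).card ≤ 2 := Finset.card_le_two
  have h5 := hF.card_closedNbhd_le Y
  norm_num at hV
  omega

end Critical

/-! ### From Ramsey-minimality to criticality -/

section Transfer

variable {U V W : Type*}

/-- If every vertex of `K` lies on an edge, a copy of `K` whose edges lie in a subgraph has its
vertices there too. -/
lemma isContained_of_map_coe {F : SimpleGraph U} {K : SimpleGraph V} (hK : ∀ v, ∃ w, K.Adj v w)
    (F' : F.Subgraph) {Y : SimpleGraph U} {X : SimpleGraph F'.verts}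
    (hY : ∀ a b, Y.Adj a b → ∃ (ha : a ∈ F'.verts) (hb : b ∈ F'.verts), X.Adj ⟨a, ha⟩ ⟨b, hb⟩)
    (h : K.IsContained Y) : K.IsContained X := by
  obtain ⟨g⟩ := h
  have hmem : ∀ v, g v ∈ F'.verts := fun v => by
    obtain ⟨w, hw⟩ := hK v
    exact (hY _ _ (g.toHom.map_adj hw)).1
  refine ⟨⟨⟨fun v => ⟨g v, hmem v⟩, fun {v w} hvw => ?_⟩, fun v w h => ?_⟩⟩
  · exact (hY _ _ (g.toHom.map_adj hvw)).2.2
  · exact g.injective (congrArg Subtype.val h)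

/-- Targets without isolated vertices cannot use the extra vertices of the spanning graph, so
minimality can be tested with the vertex set fixed. -/
lemma arrows_coe_of_spanningCoe {F : SimpleGraph U} {G : SimpleGraph V} {H : SimpleGraph W}
    (hG : ∀ v, ∃ w, G.Adj v w) (hH : ∀ v, ∃ w, H.Adj v w) (F' : F.Subgraph)
    (h : Arrows F'.spanningCoe G H) : Arrows F'.coe G H := by
  intro R hR
  have hle : R.map (Function.Embedding.subtype _) ≤ F'.spanningCoe := by
    rintro a b ⟨-, x, y, hxy, rfl, rfl⟩
    exact hR hxy
  rcases h _ hle with h | h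
  · refine .inl (isContained_of_map_coe hG F' (fun a b hab => ?_) h)
    obtain ⟨-, x, y, hxy, rfl, rfl⟩ := hab
    exact ⟨x.2, y.2, hxy⟩
  · refine .inr (isContained_of_map_coe hH F' (fun a b hab => ?_) h)
    refine ⟨F'.edge_vert hab.1, F'.edge_vert hab.1.symm, hab.1, fun hR' => hab.2 ?_⟩
    exact ⟨hab.1.ne, _, _, hR', rfl, rfl⟩

lemma starG_adj_exists {r : ℕ} (hr : 0 < r) (v : Fin 1 ⊕ Fin r) : ∃ w, (starG r).Adj v w := by
  rcases v with i | i
  · exact ⟨.inr ⟨0, hr⟩, by simp⟩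
  · exact ⟨.inl 0, by simp⟩

lemma matchingG_adj_exists {j : ℕ} (v : Fin j × Bool) : ∃ w, (matchingG j).Adj v w :=
  ⟨(v.1, !v.2), rfl, by simp⟩

lemma sum_adj_exists {G : SimpleGraph V} {H : SimpleGraph W} (hG : ∀ v, ∃ w, G.Adj v w)
    (hH : ∀ v, ∃ w, H.Adj v w) (v : V ⊕ W) : ∃ w, (G ⊕g H).Adj v w := by
  rcases v with v | v
  · obtain ⟨w, hw⟩ := hG v
    exact ⟨.inl w, by simpa using hw⟩
  · obtain ⟨w, hw⟩ := hH v
    exact ⟨.inr w, by simpa using hw⟩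

lemma redTarget_adj_exists (v) : ∃ w, redTarget.Adj v w :=
  sum_adj_exists (starG_adj_exists (by norm_num)) (starG_adj_exists (by norm_num)) v

lemma blueTarget_adj_exists (v) : ∃ w, blueTarget.Adj v w :=
  sum_adj_exists (starG_adj_exists (by norm_num)) matchingG_adj_exists v

lemma IsRamseyMinimal.isCritical {F : SimpleGraph U}
    (hF : IsRamseyMinimal F redTarget blueTarget) : IsCritical F := by
  classical
  have hmin : ∀ F' : F.Subgraph, F' ≠ ⊤ → ¬ Arrows F'.spanningCoe redTarget blueTarget :=
    fun F' h h' => hF.2 F' h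
      (arrows_coe_of_spanningCoe redTarget_adj_exists blueTarget_adj_exists F' h')
  refine ⟨fun R B hle => ?_, fun s t hst => ?_, fun v => ?_⟩
  · rcases hF.1 (R ⊓ F) inf_le_right with h | h
    · exact .inl (h.mono_right inf_le_left)
    · refine .inr (h.mono_right fun a b hab => ?_)
      exact (hle hab.1).resolve_left fun h => hab.2 ⟨h, hab.1⟩
  · have hne : toSubgraph (F.deleteEdges {s(s, t)}) (deleteEdges_le _) ≠ ⊤ := fun h => by
      have : (⊤ : F.Subgraph).Adj s t := by simpa using hst
      rw [← h] at this
      simp at this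
    have := hmin _ hne
    simp only [Arrows, not_forall, not_or] at this
    obtain ⟨R, hR, h1, h2⟩ := this
    refine ⟨R, _, h1, h2, fun a b hab => ?_⟩
    by_cases he : s(a, b) = s(s, t)
    · refine .inr ?_
      rw [edge_adj]
      exact ⟨by simpa using he, hab.ne⟩
    · refine .inl ?_
      by_cases hRab : R.Adj a b
      · exact .inl hRab
      · refine .inr ⟨?_, hRab⟩
        simp [hab]
        simpa using he
  · by_contra! hv
    have hne : (⊤ : F.Subgraph).deleteVerts {v} ≠ ⊤ := fun h => by
      have : v ∈ (⊤ : F.Subgraph).verts := by simp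
      rw [← h] at this
      simp at this
    refine hmin _ hne ?_
    -- Deleting an isolated vertex loses no edge, so the smaller graph would still arrow.
    have : ((⊤ : F.Subgraph).deleteVerts {v}).spanningCoe = F := by
      ext a b
      simp only [Subgraph.spanningCoe_adj, Subgraph.deleteVerts_adj, Subgraph.verts_top,
        Set.mem_univ, Set.mem_singleton_iff, true_and, Subgraph.top_adj]
      refine ⟨fun h => h.2.2, fun h => ⟨?_, ?_, h⟩⟩
      · rintro rfl
        exact hv _ h
      · rintro rfl
        exact hv _ h.symm
    rw [this]
    exact hF.1

/-- The pair `(S(5) ∪ S(2), S(3) ∪ 122K₂)` is Ramsey-finite. -/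
theorem ramseyFinite_targets : RamseyFinite redTarget blueTarget := by
  have hfin : (Set.range fun p : Σ n : Fin (256 ^ 4 + 1), SimpleGraph (Fin n) =>
      GraphClass.mk p.2).Finite := Set.finite_range _
  refine hfin.subset ?_
  rintro c ⟨n, F, hF, rfl⟩
  have := hF.isCritical.card_le
  rw [Fintype.card_fin] at this
  exact ⟨⟨⟨n, Nat.lt_succ_of_le this⟩, F⟩, rfl⟩

end Transfer

/-! ### Shapes of the two targets -/

section Shape

variable {V : Type*}

/-- In a matching, every vertex has at most one neighbour. -/
lemma IsMatchingGraph.eq_of_adj {G : SimpleGraph V} (h : IsMatchingGraph G) {u v w : V}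
    (hv : G.Adj u v) (hw : G.Adj u w) : v = w := by
  obtain ⟨j, ⟨e⟩⟩ := h
  have h1 := e.map_rel_iff.2 hv
  have h2 := e.map_rel_iff.2 hw
  refine e.injective (Prod.ext (h1.1.symm.trans h2.1) ?_)
  have h3 := h1.2
  have h4 := h2.2
  revert h3 h4
  cases (e u).2 <;> cases (e v).2 <;> cases (e w).2 <;> simp

/-- In `S(r) ∪ qK₂`, at most one vertex has two neighbours. -/
lemma IsStarUnionMatching.eq_of_adj {G : SimpleGraph V} {r q : ℕ}
    (h : IsStarUnionMatching G r q) {u u' a b a' b' : V} (ha : G.Adj u a) (hb : G.Adj u b)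
    (hab : a ≠ b) (ha' : G.Adj u' a') (hb' : G.Adj u' b') (hab' : a' ≠ b') : u = u' := by
  obtain ⟨e⟩ := h
  have key : ∀ x y z : (Fin 1 ⊕ Fin r) ⊕ (Fin q × Bool), (starG r ⊕g matchingG q).Adj x y →
      (starG r ⊕g matchingG q).Adj x z → y ≠ z → x = .inl (.inl 0) := by
    rintro ((x | x) | x) ((y | y) | y) ((z | z) | z) h1 h2 hyz
    all_goals simp at h1 h2
    all_goals first
      | rw [Subsingleton.elim x 0]
      | exact absurd (by rw [Subsingleton.elim y z]) hyz
      | exact absurd (congrArg Sum.inr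
          (IsMatchingGraph.eq_of_adj ⟨q, ⟨Iso.refl⟩⟩ h1 h2)) hyz
  have h1 := key _ _ _ (e.map_rel_iff.2 ha) (e.map_rel_iff.2 hb) (e.injective.ne hab)
  have h2 := key _ _ _ (e.map_rel_iff.2 ha') (e.map_rel_iff.2 hb') (e.injective.ne hab')
  exact e.injective (h1.trans h2.symm)

lemma not_isMatchingGraph_star_sum {W : Type*} {r : ℕ} (K : SimpleGraph W) :
    ¬ IsMatchingGraph (starG (r + 2) ⊕g K) := fun h => by
  have := h.eq_of_adj (u := .inl (.inl 0)) (v := .inl (.inr 0)) (w := .inl (.inr 1))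
    (by simp) (by simp)
  simp at this

lemma not_isStarUnionMatching_redTarget (r q : ℕ) : ¬ IsStarUnionMatching redTarget r q :=
  fun h => by
  have := h.eq_of_adj (u := .inl (.inl 0)) (a := .inl (.inr 0)) (b := .inl (.inr 1))
    (u' := .inr (.inl 0)) (a' := .inr (.inr 0)) (b' := .inr (.inr 1))
    (by simp) (by simp) (by simp) (by simp) (by simp) (by simp)
  simp at this

end Shape

end RamseyMin

/-! ### Refutation of the conjecture -/

open RamseyMin

theorem mainTheorem4 :
    RamseyMin.RamseyFinite
        (RamseyMin.starG 5 ⊕g RamseyMin.starG 2) (RamseyMin.starG 3 ⊕g RamseyMin.matchingG 122) ∧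
      ¬ RamseyMin.IsMatchingGraph (RamseyMin.starG 5 ⊕g RamseyMin.starG 2) ∧
      ¬ RamseyMin.IsMatchingGraph (RamseyMin.starG 3 ⊕g RamseyMin.matchingG 122) ∧
      (¬ ∃ r q : ℕ, RamseyMin.IsStarUnionMatching (RamseyMin.starG 5 ⊕g RamseyMin.starG 2) r q) ∧
      ¬ RamseyMin.BurrConjecture := by
  have hG : ¬ IsMatchingGraph redTarget := not_isMatchingGraph_star_sum (r := 3) (starG 2)
  have hH : ¬ IsMatchingGraph blueTarget := not_isMatchingGraph_star_sum (r := 1) (matchingG 122)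
  have hS : ¬ ∃ r q : ℕ, IsStarUnionMatching redTarget r q := fun ⟨r, q, h⟩ =>
    not_isStarUnionMatching_redTarget r q h
  have hne : ∀ {V : Type} {K : SimpleGraph V}, V → (∀ v, ∃ w, K.Adj v w) → IsTarget K := by
    intro V K v h
    refine ⟨fun hK => ?_, h⟩
    obtain ⟨w, hw⟩ := h v
    simp [hK] at hw
  refine ⟨ramseyFinite_targets, hG, hH, hS, fun hBurr => ?_⟩
  have := (hBurr _ _ redTarget blueTarget (hne (.inl (.inl 0)) redTarget_adj_exists)
    (hne (.inl (.inl 0)) blueTarget_adj_exists)).1 ramseyFinite_targets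
  rcases this with (h | h) | ⟨⟨r, q, -, h⟩, -⟩
  · exact hG h
  · exact hH h
  · exact hS ⟨r, q, h⟩
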